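/- Definitions. Let $\mathcal U(3)$ be the group of unitary $3\times 3$ complex matrices. A complex Hadamard matrix of order $3$ is a matrix $H$ with $HH^\dagger=3\,\mathbb I$ and $|H_{\alpha\beta}|=1$ for all $\alpha,\beta$. The decoherence of a unit vector $\psi\in\mathbb C^3$ is the probability vector $(|\psi_\alpha|^2)_\alpha$. A finite family of points of the probability simplex $\Delta_3$ is a simplex $2$-design if the average over the family of every real polynomial of degree at most $2$ equals its average over $\Delta_3$ with respect to the normalized Lebesgue measure. A finite indexed family of unit vectors in $\mathbb C^3$ is a complex projective $t$-design if the (equally weighted) average over the family of every polynomial in the components of $\psi$ and their complex conjugates, all of whose monomials have equal degrees, at most $t$, in the components and in the conjugates, equals its average over the unit sphere with respect to the unitarily invariant probability measure. A cyclic $t$-design with $k+1$ bases in dimension $3$ is generated by $U\in\mathcal U(3)$ if the $3(k+1)$ columns of $U^0=\mathbb I,U,\dots,U^k$ form a complex projective $t$-design. Two orthonormal bases $\{a_\alpha\},\{b_\beta\}$ of $\mathbb C^3$ are unbiased if $|\langle a_\alpha,b_\beta\rangle|^2=\tfrac13$ for all $\alpha,\beta$. A unitary $U\in\mathcal U(3)$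 generates MUB cyclically if the columns of $U^0,U,U^2,U^3$ form four pairwise unbiased bases. Theorem. 1. Let $V\in\mathcal U(3)$ be such that the decoherences of the three columns of $V^\dagger$ form a simplex $2$-design, and let $\Lambda$ be a diagonal unitary matrix. Then $\sqrt3\,V\Lambda V^\dagger$ is not a complex Hadamard matrix. 2. In particular, let $\phi\in\mathbb R$ and put $a_0^2=\frac13(1-\cos\phi)$, $a_1^2=\frac{\sin\phi}{2\sqrt3}+\frac{\cos\phi}6+\frac13$, $a_2^2=-\frac{\sin\phi}{2\sqrt3}+\frac{\cos\phi}6+\frac13$. If $V(\phi)\in\mathcal U(3)$ is any unitary matrix for which the squared moduli of the entries of $V(\phi)^\dagger$ are $$\begin{pmatrix}a_0^2&a_2^2&a_1^2\\a_1^2&a_0^2&a_2^2\\a_2^2&a_1^2&a_0^2\end{pmatrix},$$ and $\Lambda$ is a diagonal unitary matrix, then $\sqrt3\,V(\phi)\Lambda V(\phi)^\dagger$ is not a complex Hadamard matrix. 3. Let $t\ge2$, $k\ge0$, and let $U\in\mathcal U(3)$ generate a cyclic $t$-design with $k+1$ bases. Then for every $0\le j\le k$ the matrix $\sqrt3\,U^j$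 is not a complex Hadamard matrix, and for all $0\le i,j\le k$ the bases formed by the columns of $U^i$ and of $U^j$ are not unbiased. 4. No $U\in\mathcal U(3)$ generates MUB cyclically. -/

import Mathlib

open scoped Matrix
open MeasureTheory

noncomputable section

/-- A complex Hadamard matrix of order `d`: `H Hᴴ = d • 1`, all entries of modulus one. -/
def IsComplexHadamard {d : ℕ} (H : Matrix (Fin d) (Fin d) ℂ) : Prop :=
  H * Hᴴ = (d : ℂ) • (1 : Matrix (Fin d) (Fin d) ℂ) ∧ ∀ i j, ‖H i j‖ = 1

/-- The vector formed by the column of `A` with index `β`. -/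
def columnVec {d : ℕ} (A : Matrix (Fin d) (Fin d) ℂ) (β : Fin d) : EuclideanSpace ℂ (Fin d) :=
  WithLp.toLp 2 (fun α => A α β)

/-- Decoherence of a state with respect to the computational basis. -/
def decoherence {d : ℕ} (ψ : EuclideanSpace ℂ (Fin d)) : Fin d → ℝ :=
  fun α => ‖ψ α‖ ^ 2

/-- The solid `{x ∈ ℝⁿ : 0 ≤ x, ∑ x ≤ 1}`, which parametrizes the probability simplex with
`n + 1` vertices by the first `n` coordinates. -/
def cornerSimplex (n : ℕ) : Set (Fin n → ℝ) :=
  {x | (∀ i, 0 ≤ x i) ∧ ∑ i, x i ≤ 1}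

/-- Average of `f` over the probability simplex with `n + 1` vertices with respect to the flat
(normalized Lebesgue) measure. The parametrization `x ↦ (x, 1 - ∑ x)` is affine, so it carries
normalized Lebesgue measure to the normalized flat measure of the simplex. -/
def simplexAverage (n : ℕ) (f : (Fin (n + 1) → ℝ) → ℝ) : ℝ :=
  ⨍ x in cornerSimplex n, f (Fin.snoc x (1 - ∑ i, x i))

/-- A (finite, indexed) family of points of the probability simplex with `n + 1` vertices is a
simplex `t`-design: it averages polynomials of degree at most `t` as the whole simplex does. -/
def IsSimplexDesign {n : ℕ} (t : ℕ) {ι : Type} [Fintype ι] (p : ι → Fin (n + 1) → ℝ) : Prop :=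
  (∀ i, p i ∈ stdSimplex ℝ (Fin (n + 1))) ∧
  ∀ f : MvPolynomial (Fin (n + 1)) ℝ, f.totalDegree ≤ t →
    (1 / (Fintype.card ι : ℝ)) * ∑ i, MvPolynomial.eval (p i) f =
      simplexAverage n (fun x => MvPolynomial.eval x f)

/-- The value at the state `ψ` of a polynomial in the components of `ψ` (variables `Sum.inl α`)
and in their conjugates (variables `Sum.inr α`). -/
def stateEval {d : ℕ} (f : MvPolynomial (Fin d ⊕ Fin d) ℂ) (ψ : EuclideanSpace ℂ (Fin d)) : ℂ :=
  MvPolynomial.eval (Sum.elim (fun α => ψ α) (fun α => (starRingEnd ℂ) (ψ α))) f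

/-- `f` is balanced of order at most `t`: each monomial has equal degrees, at most `t`, in the
components and in the conjugated components. -/
def IsBalanced {d : ℕ} (t : ℕ) (f : MvPolynomial (Fin d ⊕ Fin d) ℂ) : Prop :=
  ∀ m ∈ f.support, ∑ α, m (Sum.inl α) = ∑ α, m (Sum.inr α) ∧ ∑ α, m (Sum.inl α) ≤ t

/-- Average over the unit sphere of `ℂᵈ` with respect to the unitarily invariant (surface)
measure, normalized. -/
def stateAverage (d : ℕ) (f : EuclideanSpace ℂ (Fin d) → ℂ) : ℂ :=
  ⨍ ψ : Metric.sphere (0 : EuclideanSpace ℂ (Fin d)) 1, f ψ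
    ∂((Measure.addHaar : Measure (EuclideanSpace ℂ (Fin d))).toSphere)

/-- A (finite, indexed) family of unit vectors of `ℂᵈ` is a complex projective `t`-design. -/
def IsProjectiveDesign {d : ℕ} (t : ℕ) {ι : Type} [Fintype ι]
    (ψ : ι → EuclideanSpace ℂ (Fin d)) : Prop :=
  (∀ i, ‖ψ i‖ = 1) ∧
  ∀ f : MvPolynomial (Fin d ⊕ Fin d) ℂ, IsBalanced t f →
    (1 / (Fintype.card ι : ℂ)) * ∑ i, stateEval f (ψ i) = stateAverage d (stateEval f)

/-- `U` generates a cyclic `t`-design with `k + 1` bases: `U` is unitary and the `(k + 1) d`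
columns of `U ^ 0, U, …, U ^ k` form a complex projective `t`-design. -/
def IsCyclicDesign {d : ℕ} (t k : ℕ) (U : Matrix (Fin d) (Fin d) ℂ) : Prop :=
  U ∈ Matrix.unitaryGroup (Fin d) ℂ ∧
  IsProjectiveDesign t (fun x : Fin (k + 1) × Fin d => columnVec (U ^ (x.1 : ℕ)) x.2)

/-- The columns of `A` and the columns of `B` are unbiased: `|⟨a_α, b_β⟩|² = 1 / d`. -/
def AreUnbiased {d : ℕ} (A B : Matrix (Fin d) (Fin d) ℂ) : Prop :=
  ∀ α β, ‖inner ℂ (columnVec A α) (columnVec B β)‖ ^ 2 = 1 / (d : ℝ)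

/-- `U` generates MUB cyclically: `U` is unitary and the columns of `U ^ 0, U, …, U ^ d` form
`d + 1` pairwise unbiased bases. -/
def GeneratesCyclicMUB {d : ℕ} (U : Matrix (Fin d) (Fin d) ℂ) : Prop :=
  U ∈ Matrix.unitaryGroup (Fin d) ℂ ∧
  ∀ i j : ℕ, i < j → j ≤ d → AreUnbiased (U ^ i) (U ^ j)

/-- The squared moduli `|(Vᴴ)_{αβ}|²` of the one-parameter family of eigenbases in dimension
three: the circulant matrix with rows `(a₀², a₂², a₁²)`, `(a₁², a₀², a₂²)`, `(a₂², a₁², a₀²)`. -/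
def eigenbasisModuliSq (φ : ℝ) : Matrix (Fin 3) (Fin 3) ℝ :=
  let a₀ := (1 - Real.cos φ) / 3
  let a₁ := Real.sin φ / (2 * √3) + Real.cos φ / 6 + 1 / 3
  let a₂ := -(Real.sin φ / (2 * √3)) + Real.cos φ / 6 + 1 / 3
  !![a₀, a₂, a₁; a₁, a₀, a₂; a₂, a₁, a₀]

end

/-! If `U = V Λ V†`, each diagonal entry of `U` is an average of the three eigenvalue phases with
weights `p β α = ‖V β α‖ ^ 2`, the decoherence of an eigenbasis. A complex Hadamard matrix `√3 U`
would make all three averages have squared modulus 1/3; the off-diagonal entries are never needed.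

The 2-design condition says that the columns of `p` have squared norm 1/2 and mutual inner product
1/4. They therefore lie on the circle inscribed in the triangle, 120° apart, and `p` is circulant up
to orientation (`cyclic_shift_of_inscribed_circle`). The three conditions on the averages then
become a nonsingular circulant linear system (`circulant_products_injective`), which forces every
pair of phases to have real inner product -1/3. Three unit vectors in the plane cannot do this,
since their Gram determinant vanishes.

For cyclic designs and MUB the same second moments of `p` are recovered from the columns of the
powers of `U`, whose overlaps with an eigenbasis are the same for every power
(`norm_inner_eigenvector_pow`). A projective design yields them by testing against products of
squared overlaps, whose sphere averages follow from unitary invariance. MUB yield them because they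
attain the minimum of the frame potential (`sum_overlap_of_frame_potential`). A product `(U^i)† U^j`
has the same eigenvectors as `U`, so unbiasedness is excluded by the same diagonal entries. -/

/-! ### Geometry of the probability triangle and averages of three phases -/

/-- Two points at angular distance `120°` on the circle inscribed in the triangle with vertices the
standard basis of `ℝ³` differ by a cyclic shift of coordinates. -/
theorem cyclic_shift_of_inscribed_circle {a b c x y z : ℝ}
    (h1 : a + b + c = 1) (h2 : x + y + z = 1)
    (h3 : a ^ 2 + b ^ 2 + c ^ 2 = 1 / 2) (h4 : x ^ 2 + y ^ 2 + z ^ 2 = 1 / 2)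
    (h5 : a * x + b * y + c * z = 1 / 4) :
    (x = b ∧ y = c ∧ z = a) ∨ (x = c ∧ y = a ∧ z = b) := by
  obtain rfl : c = 1 - a - b := by linarith
  obtain rfl : z = 1 - x - y := by linarith
  -- `s` is the determinant with third vector (1,1,1), i.e. the oriented area between the two points
  -- about the barycentre. Lagrange's identity gives its square, leaving the two senses of rotation.
  set s := x * (b - (1 - a - b)) + y * (1 - a - b - a) + (1 - x - y) * (a - b) with hs
  have hs2 : (s - 1 / 4) * (s + 1 / 4) = 0 := by
    have e : s ^ 2 = 3 * ((a ^ 2 + b ^ 2 + (1 - a - b) ^ 2 - 1 / 3) *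
        (x ^ 2 + y ^ 2 + (1 - x - y) ^ 2 - 1 / 3)
        - (a * x + b * y + (1 - a - b) * (1 - x - y) - 1 / 3) ^ 2) := by
      rw [hs]; ring
    rw [h3, h4, h5] at e
    linarith
  rcases mul_eq_zero.1 hs2 with h | h
  · left
    have hs' : s = 1 / 4 := by linarith
    rw [hs'] at hs
    -- `h5` and `hs` are linear in `x`, `y`, with determinant `1 - 3 (a² + b² + c²) = -1/2`.
    refine ⟨?_, ?_, ?_⟩ <;> grind
  · right
    have hs' : s = -1 / 4 := by linarith
    rw [hs'] at hs
    refine ⟨?_, ?_, ?_⟩ <;> grind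

/-- The circulant matrix of `ab`, `ac`, `bc` has determinant `(1/4) (1/16 - 3abc)`. It could vanish
only for `abc = 1/48`, but then the cubic with roots `a`, `b`, `c` would have negative discriminant.
-/
theorem circulant_products_injective {a b c X Y Z : ℝ} (h1 : a + b + c = 1)
    (h2 : a ^ 2 + b ^ 2 + c ^ 2 = 1 / 2)
    (e0 : a * b * X + a * c * Y + b * c * Z = 0)
    (e1 : b * c * X + a * b * Y + a * c * Z = 0)
    (e2 : a * c * X + b * c * Y + a * b * Z = 0) : X = 0 ∧ Y = 0 ∧ Z = 0 := by
  have hq : a * b + a * c + b * c = 1 / 4 := by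
    linear_combination ((a + b + c + 1) * h1 - h2) / 2
  have hs : 1 / 16 - 3 * (a * b * c) ≠ 0 := by
    intro hs
    have hd : ((a - b) * (b - c) * (c - a)) ^ 2 = a * b * c / 2 - 27 * (a * b * c) ^ 2 := by
      have : ((a - b) * (b - c) * (c - a)) ^ 2
        = (a + b + c) ^ 2 * (a * b + a * c + b * c) ^ 2 - 4 * (a * b + a * c + b * c) ^ 3
          - 4 * (a + b + c) ^ 3 * (a * b * c)
          + 18 * (a + b + c) * (a * b + a * c + b * c) * (a * b * c) - 27 * (a * b * c) ^ 2 := by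
        ring
      rw [this, h1, hq]; ring
    have h3 : a * b * c = 1 / 48 := by linarith
    rw [h3] at hd
    nlinarith [sq_nonneg ((a - b) * (b - c) * (c - a))]
  have hdet : (a * b) ^ 2 + (a * c) ^ 2 + (b * c) ^ 2 - (a * b) * (a * c) - (a * b) * (b * c)
      - (a * c) * (b * c) = 1 / 16 - 3 * (a * b * c) := by
    linear_combination (a * b + a * c + b * c + 1 / 4) * hq - 3 * (a * b * c) * h1
  have hsum : X + Y + Z = 0 := by
    have : (a * b + a * c + b * c) * (X + Y + Z) = 0 := by linear_combination e0 + e1 + e2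
    rw [hq] at this; linarith
  obtain rfl : Z = -X - Y := by linarith
  have hX : X = 0 := by
    have : (1 / 16 - 3 * (a * b * c)) * X = 0 := by
      rw [← hdet]
      linear_combination (a * b - a * c) * e0 - (a * c - b * c) * e1
    exact (mul_eq_zero.1 this).resolve_left hs
  have hY : Y = 0 := by
    have : (1 / 16 - 3 * (a * b * c)) * Y = 0 := by
      rw [← hdet]
      linear_combination (a * b - b * c) * e1 - (b * c - a * c) * e0
    exact (mul_eq_zero.1 this).resolve_left hs
  subst hX hY
  simp

theorem normSq_sum_three (u v w : ℂ) (p q r : ℝ) (hu : ‖u‖ = 1) (hv : ‖v‖ = 1) (hw : ‖w‖ = 1) :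
    ‖u * p + v * q + w * r‖ ^ 2 = p ^ 2 + q ^ 2 + r ^ 2 +
      2 * (p * q * (u.re * v.re + u.im * v.im) + p * r * (u.re * w.re + u.im * w.im)
        + q * r * (v.re * w.re + v.im * w.im)) := by
  have sq (z : ℂ) : ‖z‖ ^ 2 = z.re ^ 2 + z.im ^ 2 := by
    rw [← Complex.normSq_eq_norm_sq, Complex.normSq_apply]; ring
  have hu' := sq u
  have hv' := sq v
  have hw' := sq w
  rw [hu] at hu'; rw [hv] at hv'; rw [hw] at hw'
  rw [sq]
  simp only [Complex.add_re, Complex.add_im, Complex.mul_re, Complex.mul_im, Complex.ofReal_re,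
    Complex.ofReal_im, mul_zero, sub_zero, zero_add]
  linear_combination -p ^ 2 * hu' - q ^ 2 * hv' - r ^ 2 * hw'

/-- Three unit complex numbers cannot have pairwise real inner products `-1/3`. -/
theorem not_pairwise_inner_eq_neg_third {u v w : ℂ} (hu : ‖u‖ = 1) (hv : ‖v‖ = 1) (hw : ‖w‖ = 1)
    (X : u.re * v.re + u.im * v.im = -1 / 3) (Y : u.re * w.re + u.im * w.im = -1 / 3)
    (Z : v.re * w.re + v.im * w.im = -1 / 3) : False := by
  have sq (z : ℂ) (hz : ‖z‖ = 1) : z.re ^ 2 + z.im ^ 2 = 1 := by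
    have : ‖z‖ ^ 2 = z.re ^ 2 + z.im ^ 2 := by
      rw [← Complex.normSq_eq_norm_sq, Complex.normSq_apply]; ring
    rw [← this, hz, one_pow]
  -- The Gram determinant of three vectors in a plane is zero; the assumed values would make it 1 -
  -- 2/27 - 1/3 = 16/27.
  have gram : (u.re ^ 2 + u.im ^ 2) * (v.re ^ 2 + v.im ^ 2) * (w.re ^ 2 + w.im ^ 2)
      + 2 * (u.re * v.re + u.im * v.im) * (u.re * w.re + u.im * w.im) * (v.re * w.re + v.im * w.im)
      - (u.re ^ 2 + u.im ^ 2) * (v.re * w.re + v.im * w.im) ^ 2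
      - (v.re ^ 2 + v.im ^ 2) * (u.re * w.re + u.im * w.im) ^ 2
      - (w.re ^ 2 + w.im ^ 2) * (u.re * v.re + u.im * v.im) ^ 2 = 0 := by ring
  rw [sq u hu, sq v hv, sq w hw, X, Y, Z] at gram
  norm_num at gram

/-- If the rows of `p` form a simplex `2`-design (expressed by its second moments), then the
`p`-averages of three phases do not all have squared modulus `1/3`. -/
theorem exists_norm_sq_phase_average_ne {p : Fin 3 → Fin 3 → ℝ} (hrow : ∀ β, ∑ α, p β α = 1)
    (hcol : ∀ α, ∑ β, p β α = 1) (h00 : ∑ β, p β 0 * p β 0 = 1 / 2)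
    (h11 : ∑ β, p β 1 * p β 1 = 1 / 2) (h01 : ∑ β, p β 0 * p β 1 = 1 / 4)
    {l : Fin 3 → ℂ} (hl : ∀ α, ‖l α‖ = 1) :
    ¬ ∀ β, ‖∑ α, l α * (p β α : ℂ)‖ ^ 2 = 1 / 3 := by
  intro h
  simp only [Fin.sum_univ_three] at *
  have shift := cyclic_shift_of_inscribed_circle (hcol 0) (hcol 1) (by linarith) (by linarith) h01
  have n0 := h 0
  have n1 := h 1
  have n2 := h 2
  rw [normSq_sum_three _ _ _ _ _ _ (hl 0) (hl 1) (hl 2)] at n0 n1 n2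
  -- The shift by 1/3 makes the system homogeneous: the pairwise products in each row of `p` add up
  -- to 1/4, which absorbs the constant 1/3 - 1/2.
  suffices h3 : (l 0).re * (l 1).re + (l 0).im * (l 1).im + 1 / 3 = 0 ∧
      (l 0).re * (l 2).re + (l 0).im * (l 2).im + 1 / 3 = 0 ∧
      (l 1).re * (l 2).re + (l 1).im * (l 2).im + 1 / 3 = 0 from
    not_pairwise_inner_eq_neg_third (hl 0) (hl 1) (hl 2) (by linarith) (by linarith) (by linarith)
  generalize (l 0).re * (l 1).re + (l 0).im * (l 1).im = X at *
  generalize (l 0).re * (l 2).re + (l 0).im * (l 2).im = Y at *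
  generalize (l 1).re * (l 2).re + (l 1).im * (l 2).im = Z at *
  have r0 := hrow 0
  have r1 := hrow 1
  have r2 := hrow 2
  have c0 := hcol 0
  rcases shift with ⟨s0, s1, s2⟩ | ⟨s0, s1, s2⟩
  all_goals
    rw [s0] at r0 n0 h01
    rw [s1] at r1 n1 h01
    rw [s2] at r2 n2 h01
    generalize p 0 0 = a at *
    generalize p 1 0 = b at *
    generalize p 2 0 = c at *
  · obtain hc : p 0 2 = c := by linarith
    obtain ha : p 1 2 = a := by linarith
    obtain hb : p 2 2 = b := by linarith
    rw [hc] at n0; rw [ha] at n1; rw [hb] at n2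
    exact circulant_products_injective c0 (by linarith) (by linarith) (by linarith) (by linarith)
  · obtain hc : p 0 2 = b := by linarith
    obtain ha : p 1 2 = c := by linarith
    obtain hb : p 2 2 = a := by linarith
    rw [hc] at n0; rw [ha] at n1; rw [hb] at n2
    -- The opposite orientation is the same system with `b` and `c` interchanged.
    exact circulant_products_injective (a := a) (b := c) (c := b) (by linarith) (by linarith)
      (by linarith) (by linarith) (by linarith)

/-! ### Second moments of the flat measure on the triangle -/

theorem setIntegral_triangle {f : ℝ × ℝ → ℝ} (hf : Continuous f) :
    ∫ q in {q : ℝ × ℝ | 0 ≤ q.1 ∧ 0 ≤ q.2 ∧ q.1 + q.2 ≤ 1}, f q =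
      ∫ x in (0 : ℝ)..1, ∫ y in (0 : ℝ)..(1 - x), f (x, y) := by
  set S : Set (ℝ × ℝ) := {q | 0 ≤ q.1 ∧ 0 ≤ q.2 ∧ q.1 + q.2 ≤ 1} with hS
  have hcl : IsClosed S :=
    (isClosed_le continuous_const continuous_fst).inter
      ((isClosed_le continuous_const continuous_snd).inter
        (isClosed_le (continuous_fst.add continuous_snd) continuous_const))
  have hcpt : IsCompact S := by
    refine (isCompact_Icc (a := ((0, 0) : ℝ × ℝ)) (b := (1, 1))).of_isClosed_subset hcl ?_
    rintro ⟨x, y⟩ ⟨h1, h2, h3⟩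
    simp only at h1 h2 h3
    exact ⟨⟨h1, h2⟩, ⟨by simp only; linarith, by simp only; linarith⟩⟩
  have hint : Integrable (S.indicator f) (volume.prod volume) :=
    (integrable_indicator_iff hcl.measurableSet).2 (hf.continuousOn.integrableOn_compact hcpt)
  rw [← integral_indicator hcl.measurableSet, Measure.volume_eq_prod, integral_prod _ hint,
    intervalIntegral.integral_of_le zero_le_one, ← integral_Icc_eq_integral_Ioc,
    ← integral_indicator measurableSet_Icc]
  congr 1
  ext x
  by_cases hx : x ∈ Set.Icc (0 : ℝ) 1
  · rw [Set.indicator_of_mem hx, intervalIntegral.integral_of_le (by linarith [hx.2]),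
      ← integral_Icc_eq_integral_Ioc, ← integral_indicator measurableSet_Icc]
    congr 1
    ext y
    by_cases hy : y ∈ Set.Icc 0 (1 - x)
    · rw [Set.indicator_of_mem hy, Set.indicator_of_mem]
      exact ⟨hx.1, hy.1, by simp only; linarith [hy.2]⟩
    · rw [Set.indicator_of_notMem hy, Set.indicator_of_notMem]
      rintro ⟨-, h2, h3⟩
      exact hy ⟨h2, by simp only at h3; linarith⟩
  · rw [Set.indicator_of_notMem hx, ← integral_zero ℝ ℝ]
    congr 1
    ext y
    rw [Set.indicator_of_notMem]
    rintro ⟨h1, h2, h3⟩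
    exact hx ⟨h1, by simp only at h1 h2 h3; linarith⟩

theorem setIntegral_cornerSimplex_two {f : ℝ × ℝ → ℝ} (hf : Continuous f) :
    ∫ x in cornerSimplex 2, f (x 0, x 1) = ∫ x in (0 : ℝ)..1, ∫ y in (0 : ℝ)..(1 - x), f (x, y) := by
  rw [← setIntegral_triangle hf, ← (volume_preserving_finTwoArrow ℝ).setIntegral_preimage_emb
    MeasurableEquiv.finTwoArrow.measurableEmbedding]
  congr 2
  ext x
  simp [cornerSimplex, Fin.forall_fin_two, and_assoc]

theorem volume_real_cornerSimplex_two : volume.real (cornerSimplex 2) = 1 / 2 := by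
  have h := setIntegral_cornerSimplex_two (f := fun _ => 1) continuous_const
  rw [setIntegral_const, smul_eq_mul, mul_one] at h
  rw [h]
  simp only [intervalIntegral.integral_const, smul_eq_mul, mul_one, sub_zero]
  rw [intervalIntegral.integral_sub (by simp) (by simp)]
  norm_num

theorem simplexAverage_two_eq {f : (Fin 3 → ℝ) → ℝ} {g : ℝ × ℝ → ℝ} (hg : Continuous g)
    (hfg : ∀ x : Fin 3 → ℝ, f x = g (x 0, x 1)) :
    simplexAverage 2 f = 2 * ∫ x in (0 : ℝ)..1, ∫ y in (0 : ℝ)..(1 - x), g (x, y) := by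
  rw [simplexAverage, setAverage_eq, volume_real_cornerSimplex_two,
    ← setIntegral_cornerSimplex_two hg, smul_eq_mul]
  norm_num
  congr 1
  ext x
  rw [hfg]
  rfl

theorem simplexAverage_sq_fst : simplexAverage 2 (fun x => x 0 * x 0) = 1 / 6 := by
  rw [simplexAverage_two_eq (g := fun q => q.1 * q.1) (by fun_prop) (fun _ => rfl)]
  have : ∀ x : ℝ, (∫ y in (0 : ℝ)..(1 - x), x * x) = x ^ 2 - x ^ 3 := by
    intro x
    rw [intervalIntegral.integral_const, smul_eq_mul]; ring
  simp only [this]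
  rw [intervalIntegral.integral_sub (by simp) (by simp)]
  norm_num

theorem simplexAverage_sq_snd : simplexAverage 2 (fun x => x 1 * x 1) = 1 / 6 := by
  rw [simplexAverage_two_eq (g := fun q => q.2 ^ 2) (by fun_prop) (fun _ => (sq _).symm)]
  simp only [integral_pow]
  have := intervalIntegral.integral_comp_sub_left (a := 0) (b := 1) (fun x : ℝ => x ^ 3) 1
  norm_num at this ⊢
  rw [this]
  norm_num

theorem simplexAverage_fst_mul_snd : simplexAverage 2 (fun x => x 0 * x 1) = 1 / 12 := by
  rw [simplexAverage_two_eq (g := fun q => q.1 * q.2) (by fun_prop) (fun _ => rfl)]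
  have : ∀ x : ℝ, (∫ y in (0 : ℝ)..(1 - x), x * y) = (x ^ 1 - 2 * x ^ 2 + x ^ 3) / 2 := by
    intro x
    rw [intervalIntegral.integral_const_mul, integral_id]; ring
  simp only [this]
  rw [intervalIntegral.integral_div, intervalIntegral.integral_add, intervalIntegral.integral_sub,
    intervalIntegral.integral_const_mul]
  · norm_num
  all_goals exact Continuous.intervalIntegrable (by fun_prop) _ _

/-- The mixed second moments of a simplex `2`-design of three points in the triangle. -/
theorem IsSimplexDesign.sum_mul {p : Fin 3 → Fin 3 → ℝ} (h : IsSimplexDesign 2 p) (i j : Fin 3) :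
    ∑ β, p β i * p β j = 3 * simplexAverage 2 (fun x => x i * x j) := by
  have := h.2 (MvPolynomial.X i * MvPolynomial.X j)
    ((MvPolynomial.totalDegree_mul _ _).trans (by simp [MvPolynomial.totalDegree_X]))
  simp only [map_mul, MvPolynomial.eval_X, Fintype.card_fin] at this
  rw [← this]
  ring

/-! ### Invariance of the surface measure under linear isometries -/

section SphereInvariance

variable {E : Type*} [NormedAddCommGroup E] [NormedSpace ℝ E] [FiniteDimensional ℝ E]
  [MeasurableSpace E] [BorelSpace E] (μ : Measure E) [μ.IsAddHaarMeasure]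

/-- By uniqueness of Haar measure the image is a multiple of `μ`; the unit ball is mapped to itself
and has finite nonzero measure, so the factor is 1. -/
theorem LinearIsometryEquiv.map_addHaar (g : E ≃ₗᵢ[ℝ] E) : μ.map g = μ := by
  have h1 : (μ.map g).IsAddHaarMeasure :=
    g.toContinuousLinearEquiv.isAddHaarMeasure_map μ
  have h2 := Measure.isAddLeftInvariant_eq_smul (μ.map g) μ
  have h3 : (μ.map g) (Metric.ball 0 1) = μ (Metric.ball 0 1) := by
    rw [Measure.map_apply g.continuous.measurable measurableSet_ball]
    simp
  rw [h2, Measure.smul_apply] at h3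
  have h4 : μ (Metric.ball 0 1) ≠ 0 := (Metric.measure_ball_pos μ 0 one_pos).ne'
  have h5 : μ (Metric.ball 0 1) ≠ ⊤ := measure_ball_lt_top.ne
  have h6 : Measure.addHaarScalarFactor (μ.map g) μ = 1 := by
    rw [ENNReal.smul_def, smul_eq_mul, ENNReal.mul_eq_right h4 h5] at h3
    exact_mod_cast h3
  rw [h2, h6, one_smul]

/-- The restriction of a linear isometry to the unit sphere. -/
def LinearIsometryEquiv.sphereEquiv (g : E ≃ₗᵢ[ℝ] E) :
    Metric.sphere (0 : E) 1 ≃ₜ Metric.sphere (0 : E) 1 :=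
  g.toHomeomorph.subtype (fun x => by simp)

open scoped Pointwise in
theorem LinearIsometryEquiv.measurePreserving_toSphere (g : E ≃ₗᵢ[ℝ] E) :
    MeasurePreserving g.sphereEquiv μ.toSphere μ.toSphere := by
  refine ⟨g.sphereEquiv.continuous.measurable, ?_⟩
  ext s hs
  rw [Measure.map_apply g.sphereEquiv.continuous.measurable hs, μ.toSphere_apply' hs,
    μ.toSphere_apply' (g.sphereEquiv.continuous.measurable hs)]
  congr 1
  -- `toSphere` measures a set by the volume of the cone over it, and linear maps commute with
  -- forming cones.
  have hset : Set.Ioo (0 : ℝ) 1 • ((↑) '' (g.sphereEquiv ⁻¹' s) : Set E) =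
      g ⁻¹' (Set.Ioo (0 : ℝ) 1 • ((↑) '' s)) := by
    ext x
    simp only [Set.mem_smul, Set.mem_image, Set.mem_preimage]
    constructor
    · rintro ⟨r, hr, _, ⟨y, hy, rfl⟩, rfl⟩
      exact ⟨r, hr, g y, ⟨g.sphereEquiv y, hy, rfl⟩, by simp⟩
    · rintro ⟨r, hr, _, ⟨y, hy, rfl⟩, hx⟩
      refine ⟨r, hr, g.sphereEquiv.symm y, ⟨g.sphereEquiv.symm y, by simpa using hy, rfl⟩, ?_⟩
      apply g.injective
      have : g (g.sphereEquiv.symm y : E) = y :=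
        congrArg Subtype.val (g.sphereEquiv.apply_symm_apply y)
      rw [← hx, map_smul, this]
  rw [hset]
  conv_rhs => rw [← g.map_addHaar μ]
  exact (g.toHomeomorph.measurableEmbedding.map_apply μ _).symm

end SphereInvariance

/-! ### Sphere averages of products of squared overlaps -/

noncomputable section

/-- The average over the unit sphere of the product of the squared overlaps with `v` and `w`. -/
def overlapMoment (v w : EuclideanSpace ℂ (Fin 3)) : ℝ :=
  ⨍ ψ : Metric.sphere (0 : EuclideanSpace ℂ (Fin 3)) 1,
    ‖inner ℂ v (ψ : EuclideanSpace ℂ (Fin 3))‖ ^ 2 * ‖inner ℂ w (ψ : EuclideanSpace ℂ (Fin 3))‖ ^ 2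
    ∂((Measure.addHaar : Measure (EuclideanSpace ℂ (Fin 3))).toSphere)

end

theorem integrable_toSphere_of_continuous
    {f : Metric.sphere (0 : EuclideanSpace ℂ (Fin 3)) 1 → ℝ} (hf : Continuous f) :
    Integrable f ((Measure.addHaar : Measure (EuclideanSpace ℂ (Fin 3))).toSphere) :=
  integrableOn_univ.1 (hf.continuousOn.integrableOn_compact isCompact_univ)

theorem overlapMoment_map (g : EuclideanSpace ℂ (Fin 3) ≃ₗᵢ[ℂ] EuclideanSpace ℂ (Fin 3))
    (v w : EuclideanSpace ℂ (Fin 3)) : overlapMoment (g v) (g w) = overlapMoment v w := by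
  let gr : EuclideanSpace ℂ (Fin 3) ≃ₗᵢ[ℝ] EuclideanSpace ℂ (Fin 3) :=
    { g.toLinearEquiv.restrictScalars ℝ with norm_map' := g.norm_map }
  have hm := gr.measurePreserving_toSphere
    (Measure.addHaar : Measure (EuclideanSpace ℂ (Fin 3)))
  rw [overlapMoment, overlapMoment, average_eq, average_eq]
  congr 1
  rw [← hm.integral_comp gr.sphereEquiv.measurableEmbedding]
  congr 1
  ext ψ
  have : ((gr.sphereEquiv ψ : Metric.sphere (0 : EuclideanSpace ℂ (Fin 3)) 1) :
    EuclideanSpace ℂ (Fin 3)) = g ψ := rfl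
  rw [this, g.inner_map_map, g.inner_map_map]

theorem exists_linearIsometryEquiv_map_eq {v w : EuclideanSpace ℂ (Fin 3)} (hv : ‖v‖ = 1)
    (hw : ‖w‖ = 1) :
    ∃ g : EuclideanSpace ℂ (Fin 3) ≃ₗᵢ[ℂ] EuclideanSpace ℂ (Fin 3), g v = w := by
  have key (u : EuclideanSpace ℂ (Fin 3)) (hu : ‖u‖ = 1) :
      ∃ b : OrthonormalBasis (Fin 3) ℂ (EuclideanSpace ℂ (Fin 3)), b 0 = u := by
    obtain ⟨b, hb⟩ := Orthonormal.exists_orthonormalBasis_extension_of_card_eq (𝕜 := ℂ)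
      (E := EuclideanSpace ℂ (Fin 3)) (ι := Fin 3) (by simp) (v := fun _ => u) (s := {0})
      ⟨fun _ => hu, fun i j hij => (hij (Subsingleton.elim _ _)).elim⟩
    exact ⟨b, hb 0 rfl⟩
  obtain ⟨b, rfl⟩ := key v hv
  obtain ⟨c, rfl⟩ := key w hw
  exact ⟨b.equiv c (Equiv.refl _), by simp⟩

theorem overlapMoment_self_eq {v w : EuclideanSpace ℂ (Fin 3)} (hv : ‖v‖ = 1) (hw : ‖w‖ = 1) :
    overlapMoment v v = overlapMoment w w := by
  obtain ⟨g, rfl⟩ := exists_linearIsometryEquiv_map_eq hv hw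
  rw [overlapMoment_map]

/-- Summing `‖a + c b‖ ^ 4` over the fourth roots of unity `c` cancels every term that depends on
the relative phase of `a` and `b`. -/
theorem sum_norm_add_pow_four (a b : ℂ) :
    ‖a + b‖ ^ 4 + ‖a - b‖ ^ 4 + ‖a + Complex.I * b‖ ^ 4 + ‖a - Complex.I * b‖ ^ 4 =
      4 * (‖a‖ ^ 4 + ‖b‖ ^ 4 + 4 * (‖a‖ ^ 2 * ‖b‖ ^ 2)) := by
  have sq (z : ℂ) : ‖z‖ ^ 2 = z.re ^ 2 + z.im ^ 2 := by
    rw [← Complex.normSq_eq_norm_sq, Complex.normSq_apply]; ring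
  have four (z : ℂ) : ‖z‖ ^ 4 = (z.re ^ 2 + z.im ^ 2) ^ 2 := by rw [← sq]; ring
  simp only [four, sq, Complex.add_re, Complex.add_im, Complex.sub_re, Complex.sub_im,
    Complex.mul_re, Complex.mul_im, Complex.I_re, Complex.I_im]
  ring

/-- The four vectors `(v + c w)/√2`, `c ∈ {±1, ±i}`, are unit vectors, so by invariance they share
one self-moment `M`. Adding the four moments gives `4M = 2M + 4 * overlapMoment v w`. -/
theorem overlapMoment_self_eq_two_mul {v w : EuclideanSpace ℂ (Fin 3)} (hv : ‖v‖ = 1)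
    (hw : ‖w‖ = 1) (hvw : inner ℂ v w = 0) : overlapMoment v v = 2 * overlapMoment v w := by
  have unit (c : ℂ) (hc : ‖c‖ = 1) : ‖((√2 : ℂ))⁻¹ • (v + c • w)‖ = 1 := by
    have h1 : ‖v + c • w‖ ^ 2 = 2 := by
      rw [@norm_add_sq ℂ, inner_smul_right, hvw, norm_smul, hv, hw, hc]
      norm_num
    rw [norm_smul, norm_inv, Complex.norm_real, Real.norm_of_nonneg (Real.sqrt_nonneg _),
      ← h1, Real.sqrt_sq (norm_nonneg _), inv_mul_cancel₀]
    intro h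
    rw [h] at h1
    norm_num at h1
  have h1 := overlapMoment_self_eq (unit 1 (by simp)) hv
  have h2 := overlapMoment_self_eq (unit (-1) (by simp)) hv
  have h3 := overlapMoment_self_eq (unit Complex.I (by simp)) hv
  have h4 := overlapMoment_self_eq (unit (-Complex.I) (by simp)) hv
  have h5 := overlapMoment_self_eq hw hv
  have hsum : overlapMoment ((√2 : ℂ)⁻¹ • (v + (1 : ℂ) • w)) ((√2 : ℂ)⁻¹ • (v + (1 : ℂ) • w))
      + overlapMoment ((√2 : ℂ)⁻¹ • (v + (-1 : ℂ) • w)) ((√2 : ℂ)⁻¹ • (v + (-1 : ℂ) • w))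
      + overlapMoment ((√2 : ℂ)⁻¹ • (v + Complex.I • w)) ((√2 : ℂ)⁻¹ • (v + Complex.I • w))
      + overlapMoment ((√2 : ℂ)⁻¹ • (v + (-Complex.I) • w)) ((√2 : ℂ)⁻¹ • (v + (-Complex.I) • w))
      = overlapMoment v v + overlapMoment w w + 4 * overlapMoment v w := by
    simp only [overlapMoment, average_eq, smul_eq_mul]
    rw [← mul_add, ← mul_add, ← mul_add, ← mul_add, mul_left_comm 4, ← mul_add]
    congr 1
    rw [← integral_add, ← integral_add, ← integral_add, ← integral_add, ← integral_const_mul,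
      ← integral_add]
    · congr 1
      ext ψ
      have hn : ‖((√2 : ℂ))⁻¹‖ ^ 4 = 1 / 4 := by
        rw [norm_inv, Complex.norm_real, Real.norm_of_nonneg (Real.sqrt_nonneg _), inv_pow,
          show √2 ^ 4 = (√2 ^ 2) ^ 2 by ring, Real.sq_sqrt (by norm_num)]
        norm_num
      have e (c : ℂ) : ‖inner ℂ ((√2 : ℂ)⁻¹ • (v + c • w)) (ψ : EuclideanSpace ℂ (Fin 3))‖ ^ 2 *
          ‖inner ℂ ((√2 : ℂ)⁻¹ • (v + c • w)) (ψ : EuclideanSpace ℂ (Fin 3))‖ ^ 2 =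
          1 / 4 * ‖inner ℂ v (ψ : EuclideanSpace ℂ (Fin 3)) +
            (starRingEnd ℂ) c * inner ℂ w (ψ : EuclideanSpace ℂ (Fin 3))‖ ^ 4 := by
        rw [inner_smul_left, inner_add_left, inner_smul_left, norm_mul, RCLike.norm_conj, ← hn]
        ring
      have := sum_norm_add_pow_four (inner ℂ v (ψ : EuclideanSpace ℂ (Fin 3)))
        (inner ℂ w (ψ : EuclideanSpace ℂ (Fin 3)))
      simp only [e, map_one, map_neg, Complex.conj_I, one_mul, neg_mul, neg_neg,
        ← sub_eq_add_neg]
      linear_combination 1 / 4 * this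
    all_goals exact integrable_toSphere_of_continuous (by fun_prop)
  rw [h1, h2, h3, h4, h5] at hsum
  linarith

/-- By Parseval the summed integrand is the constant 1. -/
theorem sum_overlapMoment (b : OrthonormalBasis (Fin 3) ℂ (EuclideanSpace ℂ (Fin 3))) :
    ∑ α, ∑ γ, overlapMoment (b α) (b γ) = 1 := by
  have hne : (Measure.addHaar : Measure (EuclideanSpace ℂ (Fin 3))).toSphere ≠ 0 :=
    Measure.toSphere_ne_zero _
  have : NeZero (Measure.addHaar : Measure (EuclideanSpace ℂ (Fin 3))).toSphere := ⟨hne⟩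
  rw [← average_const ((Measure.addHaar : Measure (EuclideanSpace ℂ (Fin 3))).toSphere) (1 : ℝ)]
  simp only [overlapMoment, average_eq, smul_eq_mul, ← Finset.mul_sum]
  congr 1
  rw [show ∑ α, ∑ γ, ∫ ψ : Metric.sphere (0 : EuclideanSpace ℂ (Fin 3)) 1,
      ‖inner ℂ (b α) (ψ : EuclideanSpace ℂ (Fin 3))‖ ^ 2 *
        ‖inner ℂ (b γ) (ψ : EuclideanSpace ℂ (Fin 3))‖ ^ 2
        ∂((Measure.addHaar : Measure (EuclideanSpace ℂ (Fin 3))).toSphere) =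
      ∫ ψ : Metric.sphere (0 : EuclideanSpace ℂ (Fin 3)) 1, ∑ α, ∑ γ,
        ‖inner ℂ (b α) (ψ : EuclideanSpace ℂ (Fin 3))‖ ^ 2 *
        ‖inner ℂ (b γ) (ψ : EuclideanSpace ℂ (Fin 3))‖ ^ 2
        ∂((Measure.addHaar : Measure (EuclideanSpace ℂ (Fin 3))).toSphere) from ?_]
  · congr 1
    ext ψ
    rw [← Finset.sum_mul_sum, b.sum_sq_norm_inner_right]
    simp
  · rw [integral_finsetSum _ fun α _ => integrable_toSphere_of_continuous (by fun_prop)]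
    refine Finset.sum_congr rfl fun α _ => ?_
    rw [integral_finsetSum _ fun γ _ => integrable_toSphere_of_continuous (by fun_prop)]

theorem overlapMoment_orthonormalBasis
    (b : OrthonormalBasis (Fin 3) ℂ (EuclideanSpace ℂ (Fin 3))) (α γ : Fin 3) :
    overlapMoment (b α) (b γ) = if α = γ then 1 / 6 else 1 / 12 := by
  have hs := sum_overlapMoment b
  have h0 (i j : Fin 3) : overlapMoment (b i) (b i) = overlapMoment (b j) (b j) :=
    overlapMoment_self_eq (b.norm_eq_one i) (b.norm_eq_one j)
  have h1 (i j : Fin 3) (h : i ≠ j) := overlapMoment_self_eq_two_mul (b.norm_eq_one i)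
    (b.norm_eq_one j) (b.inner_eq_zero h)
  -- Three diagonal moments `M` and six off-diagonal moments `M/2` add up to 1.
  have hd : ∀ i, overlapMoment (b i) (b i) = 1 / 6 := by
    intro i
    simp only [Fin.sum_univ_three] at hs
    have := h0 i 0
    have := h0 0 1
    have := h0 0 2
    have := h1 0 1 (by decide)
    have := h1 0 2 (by decide)
    have := h1 1 0 (by decide)
    have := h1 1 2 (by decide)
    have := h1 2 0 (by decide)
    have := h1 2 1 (by decide)
    linarith
  split_ifs with h
  · rw [h, hd]
  · have := h1 α γ h
    rw [hd] at this
    linarith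

/-! ### Diagonalization of unitary matrices by the Cayley transform -/

/-- Every unitary matrix is unitarily diagonalizable with unimodular eigenvalues. -/
theorem exists_unitary_diagonalization {n : Type*} [Fintype n] [DecidableEq n] {U : Matrix n n ℂ}
    (hU : U ∈ Matrix.unitaryGroup n ℂ) :
    ∃ V ∈ Matrix.unitaryGroup n ℂ, ∃ l : n → ℂ, (∀ α, ‖l α‖ = 1) ∧
      U = V * Matrix.diagonal l * Vᴴ := by
  have hU1 : Uᴴ * U = 1 := Matrix.mem_unitaryGroup_iff'.1 hU
  have hU2 : U * Uᴴ = 1 := Matrix.mem_unitaryGroup_iff.1 hU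
  -- a point `c` of the unit circle outside the spectrum
  obtain ⟨c, hc, hdet⟩ : ∃ c : ℂ, ‖c‖ = 1 ∧ IsUnit (c • (1 : Matrix n n ℂ) - U) := by
    have hfin : (spectrum ℂ U).Finite := Matrix.finite_spectrum U
    have hinf : (Metric.sphere (0 : ℂ) 1).Infinite := by
      refine (isPreconnected_sphere (by rw [Complex.rank_real_complex]; norm_num) _ _)
        |>.infinite_of_nontrivial ⟨1, by simp, -1, by simp, by norm_num⟩
    obtain ⟨c, hc, hc'⟩ := hinf.exists_notMem_finite hfin
    refine ⟨c, by simpa using hc, ?_⟩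
    rw [spectrum.notMem_iff, Algebra.algebraMap_eq_smul_one] at hc'
    exact hc'
  set W := c • (1 : Matrix n n ℂ) - U with hW
  have hcc : c * (starRingEnd ℂ) c = 1 := by
    rw [Complex.mul_conj, Complex.normSq_eq_norm_sq, hc]; norm_num
  obtain ⟨W', hW1, hW2⟩ : ∃ W' : Matrix n n ℂ, W * W' = 1 ∧ W' * W = 1 :=
    ⟨↑hdet.unit⁻¹, hdet.mul_val_inv, hdet.val_inv_mul⟩
  have hcomm : W * (c • 1 + U) = (c • 1 + U) * W := by
    simp only [hW, sub_mul, mul_sub, add_mul, mul_add, smul_mul_assoc, mul_smul_comm, one_mul,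
      mul_one, smul_add, smul_sub]
    abel
  -- the Cayley transform of `U`
  obtain ⟨H, hHW, hWH⟩ : ∃ H : Matrix n n ℂ, H * W = Complex.I • (c • 1 + U) ∧
      W * H = Complex.I • (c • 1 + U) := by
    refine ⟨Complex.I • ((c • 1 + U) * W'), ?_, ?_⟩
    · rw [smul_mul_assoc, mul_assoc, hW2, mul_one]
    · rw [mul_smul_comm, ← mul_assoc, hcomm, mul_assoc, hW1, mul_one]
  have hHerm : H.IsHermitian := by
    have e : Wᴴ * (Hᴴ * W) = Wᴴ * (H * W) := by
      rw [hHW, ← mul_assoc, ← Matrix.conjTranspose_mul, hHW]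
      simp only [hW, Matrix.conjTranspose_smul, Matrix.conjTranspose_add, Matrix.conjTranspose_sub,
        Matrix.conjTranspose_one, RCLike.star_def, Complex.conj_I, sub_mul, mul_sub, add_mul,
        mul_add, smul_mul_assoc, mul_smul_comm, one_mul, mul_one, hU1, smul_add, smul_sub,
        smul_smul]
      simp only [map_mul, Complex.conj_I]
      match_scalars
      · linear_combination (-2 * Complex.I) * hcc
      · ring
      · ring
    have h1 : Hᴴ * W = H * W := by
      have hu : W'ᴴ * Wᴴ = 1 := by rw [← Matrix.conjTranspose_mul, hW1, Matrix.conjTranspose_one]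
      rw [← one_mul (Hᴴ * W), ← hu, mul_assoc, e, ← mul_assoc, hu, one_mul]
    rw [Matrix.IsHermitian, ← mul_one Hᴴ, ← hW1, ← mul_assoc, h1, mul_assoc, hW1, mul_one]
  -- The inverse Cayley transform: `U = c (H - i)(H + i)⁻¹`, so an eigenbasis of the Hermitian `H`
  -- diagonalizes `U`.
  have hUH : U * (H + Complex.I • 1) = c • (H - Complex.I • 1) := by
    simp only [hW, sub_mul, smul_mul_assoc, one_mul] at hWH
    rw [mul_add, smul_sub, mul_smul_comm, mul_one, sub_eq_iff_eq_add.1 hWH, smul_add, smul_smul,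
      smul_smul, mul_comm c]
    abel
  set V : Matrix n n ℂ := ↑hHerm.eigenvectorUnitary with hV
  have hVmem : V ∈ Matrix.unitaryGroup n ℂ := hHerm.eigenvectorUnitary.2
  have hV1 : Vᴴ * V = 1 := Matrix.mem_unitaryGroup_iff'.1 hVmem
  have hV2 : V * Vᴴ = 1 := Matrix.mem_unitaryGroup_iff.1 hVmem
  set d := hHerm.eigenvalues
  have hspec : H = V * Matrix.diagonal (fun j => (d j : ℂ)) * Vᴴ := by
    conv_lhs => rw [hHerm.spectral_theorem]
    rfl
  have hdI (j : n) : (d j : ℂ) + Complex.I ≠ 0 := by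
    intro h
    simpa using congrArg Complex.im h
  have hnorm (j : n) : ‖(d j : ℂ) - Complex.I‖ = ‖(d j : ℂ) + Complex.I‖ := by
    rw [← RCLike.norm_conj]
    simp [sub_neg_eq_add]
  refine ⟨V, hVmem, fun j => c * ((d j : ℂ) - Complex.I) * ((d j : ℂ) + Complex.I)⁻¹, fun j => ?_, ?_⟩
  · rw [norm_mul, norm_mul, hc, hnorm, norm_inv, one_mul, mul_inv_cancel₀ (norm_ne_zero_iff.2 (hdI j))]
  have hD (z : ℂ) : V * Matrix.diagonal (fun j => (d j : ℂ) + z) * Vᴴ = H + z • 1 := by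
    rw [← Matrix.diagonal_add, mul_add, add_mul, ← hspec, ← Matrix.smul_one_eq_diagonal, mul_smul_comm,
      smul_mul_assoc, mul_one, hV2]
  have h3 : U * V * Matrix.diagonal (fun j => (d j : ℂ) + Complex.I) =
      V * (c • Matrix.diagonal (fun j => (d j : ℂ) - Complex.I)) := by
    have h4 := hD (-Complex.I)
    simp only [← sub_eq_add_neg, neg_smul] at h4
    rw [← hD, ← h4] at hUH
    have := congrArg (· * V) hUH
    simp only [mul_assoc, hV1, mul_one, smul_mul_assoc] at this
    rw [mul_assoc, this, mul_smul_comm]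
  have h5 : U * V = V * Matrix.diagonal
      (fun j => c * ((d j : ℂ) - Complex.I) * ((d j : ℂ) + Complex.I)⁻¹) := by
    have := congrArg (· * Matrix.diagonal (fun j => ((d j : ℂ) + Complex.I)⁻¹)) h3
    simp only [mul_assoc, Matrix.diagonal_mul_diagonal, smul_mul_assoc] at this
    simp only [mul_inv_cancel₀ (hdI _), Matrix.diagonal_one, mul_one, ← Matrix.diagonal_smul] at this
    rw [this]
    congr 2
    ext j
    simp [mul_assoc]
  rw [← h5, mul_assoc, hV2, mul_one]

/-! ### Minimal frame potential determines second moments -/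

noncomputable section

/-- The tensor `v ⊗ v̄ ⊗ w̄ ⊗ w`. -/
def overlapTensor (v w : EuclideanSpace ℂ (Fin 3)) :
    EuclideanSpace ℂ ((Fin 3 × Fin 3) × (Fin 3 × Fin 3)) :=
  WithLp.toLp 2 fun i => v i.1.1 * (starRingEnd ℂ) (v i.1.2) *
    ((starRingEnd ℂ) (w i.2.1) * w i.2.2)

/-- The tensor of the unitarily invariant second moment (up to normalization). -/
def invariantTensor : EuclideanSpace ℂ ((Fin 3 × Fin 3) × (Fin 3 × Fin 3)) :=
  WithLp.toLp 2 fun i => (if i.1.1 = i.2.1 then 1 else 0) * (if i.1.2 = i.2.2 then 1 else 0) +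
    (if i.1.1 = i.1.2 then 1 else 0) * (if i.2.1 = i.2.2 then 1 else 0)

end

theorem inner_eq_sum (v w : EuclideanSpace ℂ (Fin 3)) :
    inner ℂ v w = ∑ a, (starRingEnd ℂ) (v a) * w a := by
  simp [PiLp.inner_apply, mul_comm]

theorem norm_inner_sq_eq_sum (v w : EuclideanSpace ℂ (Fin 3)) :
    ((‖inner ℂ v w‖ ^ 2 : ℝ) : ℂ) =
      (∑ a, (starRingEnd ℂ) (v a) * w a) * ∑ a, v a * (starRingEnd ℂ) (w a) := by
  rw [Complex.ofReal_pow, ← Complex.mul_conj', inner_eq_sum, map_sum]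
  simp

/-- This turns the frame potential into the squared norm of a sum of tensors, and second moments
into inner products with that sum. -/
theorem inner_overlapTensor (v w x y : EuclideanSpace ℂ (Fin 3)) :
    inner ℂ (overlapTensor v w) (overlapTensor x y) =
      ((‖inner ℂ v x‖ ^ 2 * ‖inner ℂ w y‖ ^ 2 : ℝ) : ℂ) := by
  have prod (f g : Fin 3 → ℂ) :
      (∑ a, f a) * ∑ b, g b = ∑ i : Fin 3 × Fin 3, f i.1 * g i.2 := by
    rw [Finset.sum_mul_sum, Fintype.sum_prod_type]
  rw [Complex.ofReal_mul, norm_inner_sq_eq_sum, norm_inner_sq_eq_sum,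
    mul_comm (∑ a, (starRingEnd ℂ) (w a) * y a), PiLp.inner_apply, Fintype.sum_prod_type, prod, prod, Finset.sum_mul_sum]
  refine Finset.sum_congr rfl fun i _ => Finset.sum_congr rfl fun j _ => ?_
  simp [overlapTensor]
  ring

theorem inner_overlapTensor_invariantTensor (v w : EuclideanSpace ℂ (Fin 3)) :
    inner ℂ (overlapTensor v w) invariantTensor =
      ((‖v‖ ^ 2 * ‖w‖ ^ 2 + ‖inner ℂ v w‖ ^ 2 : ℝ) : ℂ) := by
  have hn (u : EuclideanSpace ℂ (Fin 3)) :
      ((‖u‖ ^ 2 : ℝ) : ℂ) = ∑ a, u a * (starRingEnd ℂ) (u a) := by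
    rw [Complex.ofReal_pow, ← Complex.coe_algebraMap, ← inner_self_eq_norm_sq_to_K (𝕜 := ℂ),
      inner_eq_sum]
    simp only [mul_comm]
  rw [Complex.ofReal_add, Complex.ofReal_mul, norm_inner_sq_eq_sum, hn, hn]
  simp only [PiLp.inner_apply, Fintype.sum_prod_type, Fin.sum_univ_three, overlapTensor,
    invariantTensor, RCLike.inner_apply]
  simp
  ring

theorem inner_invariantTensor_self : inner ℂ invariantTensor invariantTensor = (24 : ℂ) := by
  simp only [PiLp.inner_apply, Fintype.sum_prod_type, Fin.sum_univ_three,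
    invariantTensor, RCLike.inner_apply]
  simp
  norm_num

/-- Twelve unit vectors of `ℂ³` with minimal frame potential have the second moments of a complex
projective `2`-design. -/
theorem sum_overlap_of_frame_potential {ι : Type*} [Fintype ι]
    {ψ : ι → EuclideanSpace ℂ (Fin 3)} (hψ : ∀ x, ‖ψ x‖ = 1) (hcard : Fintype.card ι = 12)
    (hpot : ∑ x, ∑ y, ‖inner ℂ (ψ x) (ψ y)‖ ^ 2 * ‖inner ℂ (ψ x) (ψ y)‖ ^ 2 = 24)
    (v w : EuclideanSpace ℂ (Fin 3)) :
    ∑ x, ‖inner ℂ v (ψ x)‖ ^ 2 * ‖inner ℂ w (ψ x)‖ ^ 2 =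
      ‖v‖ ^ 2 * ‖w‖ ^ 2 + ‖inner ℂ v w‖ ^ 2 := by
  have hTW (x : ι) : inner ℂ (overlapTensor (ψ x) (ψ x)) invariantTensor = (2 : ℂ) := by
    rw [inner_overlapTensor_invariantTensor, inner_self_eq_norm_sq_to_K, hψ]
    norm_num
  have hWT (x : ι) : inner ℂ invariantTensor (overlapTensor (ψ x) (ψ x)) = (2 : ℂ) := by
    rw [← inner_conj_symm, hTW, Complex.conj_ofNat]
  -- Equality in the Welch bound: the squared norm of the difference is 24 - 2·(12·2) + 24 = 0.
  have hS : ∑ x, overlapTensor (ψ x) (ψ x) = invariantTensor := by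
    rw [← sub_eq_zero, ← inner_self_eq_zero (𝕜 := ℂ), inner_sub_left, inner_sub_right,
      inner_sub_right, sum_inner, sum_inner, inner_sum, inner_invariantTensor_self]
    simp only [inner_sum, hTW, hWT, inner_overlapTensor, Finset.sum_const, Finset.card_univ, hcard]
    simp only [← Complex.ofReal_sum, hpot]
    norm_num
  have h := inner_overlapTensor_invariantTensor v w
  rw [← hS, inner_sum] at h
  simp only [inner_overlapTensor] at h
  exact_mod_cast h

/-! ### Diagonal entries and Hadamard matrices -/

theorem unitary_conj_diagonal_apply (V : Matrix (Fin 3) (Fin 3) ℂ) (l : Fin 3 → ℂ) (β : Fin 3) :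
    (V * Matrix.diagonal l * Vᴴ) β β = ∑ α, l α * ((‖V β α‖ ^ 2 : ℝ) : ℂ) := by
  rw [Matrix.mul_apply]
  refine Finset.sum_congr rfl fun α _ => ?_
  rw [Matrix.mul_diagonal, Matrix.conjTranspose_apply, RCLike.star_def, Complex.ofReal_pow,
    ← Complex.mul_conj']
  ring

theorem sum_norm_sq_row {V : Matrix (Fin 3) (Fin 3) ℂ} (hV : V ∈ Matrix.unitaryGroup (Fin 3) ℂ)
    (β : Fin 3) : ∑ α, ‖V β α‖ ^ 2 = 1 := by
  have h := congrFun (congrFun (Matrix.mem_unitaryGroup_iff.1 hV) β) β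
  rw [Matrix.mul_apply, Matrix.one_apply_eq] at h
  simp only [Matrix.star_apply, RCLike.star_def, Complex.mul_conj'] at h
  exact_mod_cast h

theorem sum_norm_sq_col {V : Matrix (Fin 3) (Fin 3) ℂ} (hV : V ∈ Matrix.unitaryGroup (Fin 3) ℂ)
    (α : Fin 3) : ∑ β, ‖V β α‖ ^ 2 = 1 := by
  have h := congrFun (congrFun (Matrix.mem_unitaryGroup_iff'.1 hV) α) α
  rw [Matrix.mul_apply, Matrix.one_apply_eq] at h
  simp only [Matrix.star_apply, RCLike.star_def, Complex.conj_mul'] at h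
  exact_mod_cast h

/-- If the squared moduli of the rows of `V` have the second moments of a simplex `2`-design, the
diagonal entries of `V Λ Vᴴ` do not all have squared modulus `1/3`. -/
theorem exists_diagonal_norm_sq_ne {V : Matrix (Fin 3) (Fin 3) ℂ}
    (hV : V ∈ Matrix.unitaryGroup (Fin 3) ℂ) (h00 : ∑ β, ‖V β 0‖ ^ 2 * ‖V β 0‖ ^ 2 = 1 / 2)
    (h11 : ∑ β, ‖V β 1‖ ^ 2 * ‖V β 1‖ ^ 2 = 1 / 2) (h01 : ∑ β, ‖V β 0‖ ^ 2 * ‖V β 1‖ ^ 2 = 1 / 4)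
    {l : Fin 3 → ℂ} (hl : ∀ α, ‖l α‖ = 1) :
    ¬ ∀ β, ‖(V * Matrix.diagonal l * Vᴴ) β β‖ ^ 2 = 1 / 3 := by
  simp only [unitary_conj_diagonal_apply]
  exact exists_norm_sq_phase_average_ne (p := fun β α => ‖V β α‖ ^ 2) (sum_norm_sq_row hV)
    (sum_norm_sq_col hV) h00 h11 h01 hl

theorem IsComplexHadamard.norm_sq_of_sqrt_three_smul {A : Matrix (Fin 3) (Fin 3) ℂ}
    (h : IsComplexHadamard ((√3 : ℂ) • A)) (i j : Fin 3) : ‖A i j‖ ^ 2 = 1 / 3 := by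
  have h1 := h.2 i j
  rw [Matrix.smul_apply, smul_eq_mul, norm_mul, Complex.norm_real,
    Real.norm_of_nonneg (Real.sqrt_nonneg _)] at h1
  have h2 : √3 ^ 2 * ‖A i j‖ ^ 2 = 1 := by rw [← mul_pow, h1, one_pow]
  rw [Real.sq_sqrt (by norm_num)] at h2
  linarith

theorem not_isComplexHadamard_of_isSimplexDesign {V : Matrix (Fin 3) (Fin 3) ℂ}
    (hV : V ∈ Matrix.unitaryGroup (Fin 3) ℂ) {l : Fin 3 → ℂ} (hl : ∀ α, ‖l α‖ = 1)
    (hd : IsSimplexDesign 2 (fun β : Fin 3 => decoherence (columnVec Vᴴ β))) :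
    ¬ IsComplexHadamard ((√3 : ℂ) • (V * Matrix.diagonal l * Vᴴ)) := by
  intro h
  have e (α γ : Fin 3) : ∑ β, ‖V β α‖ ^ 2 * ‖V β γ‖ ^ 2 =
      3 * simplexAverage 2 (fun x => x α * x γ) := by
    rw [← hd.sum_mul]
    simp [decoherence, columnVec]
  refine exists_diagonal_norm_sq_ne hV ?_ ?_ ?_ hl fun β => h.norm_sq_of_sqrt_three_smul β β
  · rw [e, simplexAverage_sq_fst]; norm_num
  · rw [e, simplexAverage_sq_snd]; norm_num
  · rw [e, simplexAverage_fst_mul_snd]; norm_num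

/-- The second moments are checked directly from the explicit circulant moduli, with no integration
over the simplex. -/
theorem not_isComplexHadamard_of_moduli {φ : ℝ} {V : Matrix (Fin 3) (Fin 3) ℂ}
    (hV : V ∈ Matrix.unitaryGroup (Fin 3) ℂ) {l : Fin 3 → ℂ} (hl : ∀ α, ‖l α‖ = 1)
    (hm : ∀ α β, ‖Vᴴ α β‖ ^ 2 = eigenbasisModuliSq φ α β) :
    ¬ IsComplexHadamard ((√3 : ℂ) • (V * Matrix.diagonal l * Vᴴ)) := by
  intro h
  have e (α β : Fin 3) : ‖V β α‖ ^ 2 = eigenbasisModuliSq φ α β := by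
    rw [← hm]; simp
  have h3 : √3 ^ 2 = 3 := Real.sq_sqrt (by norm_num)
  have h30 : √3 ≠ 0 := by positivity
  have hs : (Real.sin φ / (2 * √3)) ^ 2 = (1 - Real.cos φ ^ 2) / 12 := by
    rw [div_pow, mul_pow, h3, Real.sin_sq]; norm_num
  refine exists_diagonal_norm_sq_ne hV ?_ ?_ ?_ hl fun β => h.norm_sq_of_sqrt_three_smul β β
  all_goals
    simp only [Fin.sum_univ_three, e]
    simp [eigenbasisModuliSq]
    generalize Real.sin φ / (2 * √3) = s at *
    generalize Real.cos φ = c at *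
  · linear_combination 2 * hs
  · linear_combination 2 * hs
  · linear_combination -hs

/-! ### Powers of a diagonalized unitary and their columns -/

theorem pow_unitary_conj_diagonal {V : Matrix (Fin 3) (Fin 3) ℂ}
    (hV : V ∈ Matrix.unitaryGroup (Fin 3) ℂ) (l : Fin 3 → ℂ) (k : ℕ) :
    (V * Matrix.diagonal l * Vᴴ) ^ k = V * Matrix.diagonal (l ^ k) * Vᴴ := by
  have hV1 : Vᴴ * V = 1 := Matrix.mem_unitaryGroup_iff'.1 hV
  have hV2 : V * Vᴴ = 1 := Matrix.mem_unitaryGroup_iff.1 hV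
  induction k with
  | zero => simp [Pi.one_def, hV2]
  | succ k ih =>
    rw [pow_succ, ih, show V * Matrix.diagonal (l ^ k) * Vᴴ * (V * Matrix.diagonal l * Vᴴ) =
      V * Matrix.diagonal (l ^ k) * (Vᴴ * V) * Matrix.diagonal l * Vᴴ by simp only [mul_assoc],
      hV1, mul_one, mul_assoc V, Matrix.diagonal_mul_diagonal, pow_succ]
    rfl

theorem inner_columnVec (A B : Matrix (Fin 3) (Fin 3) ℂ) (α β : Fin 3) :
    inner ℂ (columnVec A α) (columnVec B β) = (Aᴴ * B) α β := by
  rw [inner_eq_sum, Matrix.mul_apply]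
  rfl

/-- The columns of a unitary matrix as an orthonormal basis. -/
theorem exists_orthonormalBasis_columnVec {V : Matrix (Fin 3) (Fin 3) ℂ}
    (hV : V ∈ Matrix.unitaryGroup (Fin 3) ℂ) :
    ∃ b : OrthonormalBasis (Fin 3) ℂ (EuclideanSpace ℂ (Fin 3)), ∀ α, b α = columnVec V α := by
  have ho : Orthonormal ℂ (columnVec V) := by
    rw [orthonormal_iff_ite]
    intro i j
    rw [inner_columnVec, show Vᴴ * V = 1 from Matrix.mem_unitaryGroup_iff'.1 hV, Matrix.one_apply]
  obtain ⟨b, hb⟩ := Orthonormal.exists_orthonormalBasis_extension_of_card_eq (𝕜 := ℂ)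
    (E := EuclideanSpace ℂ (Fin 3)) (ι := Fin 3) (by simp) (v := columnVec V) (s := Set.univ)
    (ho.comp _ Subtype.val_injective)
  exact ⟨b, fun α => hb α trivial⟩

/-- The overlaps of the columns of `U ^ k` with an eigenbasis of `U` do not depend on `k`. -/
theorem norm_inner_eigenvector_pow {V : Matrix (Fin 3) (Fin 3) ℂ}
    (hV : V ∈ Matrix.unitaryGroup (Fin 3) ℂ) {l : Fin 3 → ℂ} (hl : ∀ α, ‖l α‖ = 1) (k : ℕ)
    (α β : Fin 3) :
    ‖inner ℂ (columnVec V α) (columnVec ((V * Matrix.diagonal l * Vᴴ) ^ k) β)‖ = ‖V β α‖ := by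
  have hV1 : Vᴴ * V = 1 := Matrix.mem_unitaryGroup_iff'.1 hV
  rw [inner_columnVec, pow_unitary_conj_diagonal hV, mul_assoc V, ← mul_assoc, hV1, one_mul,
    Matrix.diagonal_mul, norm_mul, Pi.pow_apply, norm_pow, hl, one_pow, one_mul]
  simp

/-! ### Test polynomials and cyclic designs -/

noncomputable section

/-- The polynomial `⟨v, ψ⟩` in the components of `ψ`. -/
def overlapPoly (v : EuclideanSpace ℂ (Fin 3)) : MvPolynomial (Fin 3 ⊕ Fin 3) ℂ :=
  ∑ a, MvPolynomial.C ((starRingEnd ℂ) (v a)) * MvPolynomial.X (Sum.inl a)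

/-- The polynomial `⟨ψ, v⟩` in the conjugated components of `ψ`. -/
def overlapPolyConj (v : EuclideanSpace ℂ (Fin 3)) : MvPolynomial (Fin 3 ⊕ Fin 3) ℂ :=
  ∑ a, MvPolynomial.C (v a) * MvPolynomial.X (Sum.inr a)

/-- The polynomial `|⟨v, ψ⟩|² |⟨w, ψ⟩|²`. -/
def overlapSqPoly (v w : EuclideanSpace ℂ (Fin 3)) : MvPolynomial (Fin 3 ⊕ Fin 3) ℂ :=
  overlapPoly v * overlapPolyConj v * (overlapPoly w * overlapPolyConj w)

end

theorem stateEval_overlapSqPoly (v w ψ : EuclideanSpace ℂ (Fin 3)) :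
    stateEval (overlapSqPoly v w) ψ =
      ((‖inner ℂ v ψ‖ ^ 2 * ‖inner ℂ w ψ‖ ^ 2 : ℝ) : ℂ) := by
  rw [Complex.ofReal_mul, norm_inner_sq_eq_sum, norm_inner_sq_eq_sum]
  simp [stateEval, overlapSqPoly, overlapPoly, overlapPolyConj]

theorem isWeightedHomogeneous_sum_C_mul_X (w : Fin 3 ⊕ Fin 3 → ℕ) (c : Fin 3 → ℂ)
    (s : Fin 3 → Fin 3 ⊕ Fin 3) (n : ℕ) (hw : ∀ a, w (s a) = n) :
    MvPolynomial.IsWeightedHomogeneous w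
      (∑ a, MvPolynomial.C (c a) * MvPolynomial.X (s a)) n := by
  refine MvPolynomial.IsWeightedHomogeneous.sum _ _ _ fun a _ => ?_
  have := (MvPolynomial.isWeightedHomogeneous_C w (c a)).mul
    (MvPolynomial.isWeightedHomogeneous_X ℂ w (s a))
  rwa [zero_add, hw] at this

theorem isBalanced_overlapSqPoly {t : ℕ} (ht : 2 ≤ t) (v w : EuclideanSpace ℂ (Fin 3)) :
    IsBalanced t (overlapSqPoly v w) := by
  -- The gradings by the components and by the conjugates are tracked by two 0-1 weights; each
  -- squared overlap has degree 1 in both.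
  have hl (u : EuclideanSpace ℂ (Fin 3)) : MvPolynomial.IsWeightedHomogeneous
      (Sum.elim (fun _ => 1) (fun _ => 0) : Fin 3 ⊕ Fin 3 → ℕ)
      (overlapPoly u * overlapPolyConj u) (1 + 0) :=
    (isWeightedHomogeneous_sum_C_mul_X _ _ _ 1 fun _ => rfl).mul
      (isWeightedHomogeneous_sum_C_mul_X _ _ _ 0 fun _ => rfl)
  have hr (u : EuclideanSpace ℂ (Fin 3)) : MvPolynomial.IsWeightedHomogeneous
      (Sum.elim (fun _ => 0) (fun _ => 1) : Fin 3 ⊕ Fin 3 → ℕ)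
      (overlapPoly u * overlapPolyConj u) (0 + 1) :=
    (isWeightedHomogeneous_sum_C_mul_X _ _ _ 0 fun _ => rfl).mul
      (isWeightedHomogeneous_sum_C_mul_X _ _ _ 1 fun _ => rfl)
  intro m hm
  have h1 := (hl v).mul (hl w) (MvPolynomial.mem_support_iff.1 hm)
  have h2 := (hr v).mul (hr w) (MvPolynomial.mem_support_iff.1 hm)
  rw [Finsupp.weight_apply, Finsupp.sum_fintype _ _ (by simp), Fintype.sum_sum_type] at h1 h2
  simp only [Sum.elim_inl, Sum.elim_inr, smul_eq_mul, mul_one, mul_zero, Finset.sum_const_zero,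
    add_zero, zero_add] at h1 h2
  omega

theorem stateAverage_overlapSqPoly (v w : EuclideanSpace ℂ (Fin 3)) :
    stateAverage 3 (stateEval (overlapSqPoly v w)) = (overlapMoment v w : ℂ) := by
  rw [stateAverage, overlapMoment, average_eq, average_eq]
  simp only [stateEval_overlapSqPoly]
  rw [integral_complex_ofReal, smul_eq_mul, Complex.ofReal_mul, Complex.real_smul]

/-- All `k + 1` powers contribute the same sum over `β`, so the design average is one third of it;
this gives three times the sphere moments 1/6 and 1/12. -/
theorem IsCyclicDesign.sum_mul {t k : ℕ} (ht : 2 ≤ t) {V : Matrix (Fin 3) (Fin 3) ℂ}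
    (hV : V ∈ Matrix.unitaryGroup (Fin 3) ℂ) {l : Fin 3 → ℂ} (hl : ∀ α, ‖l α‖ = 1)
    (h : IsCyclicDesign t k (V * Matrix.diagonal l * Vᴴ)) (α γ : Fin 3) :
    ∑ β, ‖V β α‖ ^ 2 * ‖V β γ‖ ^ 2 = if α = γ then 1 / 2 else 1 / 4 := by
  obtain ⟨b, hb⟩ := exists_orthonormalBasis_columnVec hV
  have h1 := h.2.2 _ (isBalanced_overlapSqPoly ht (columnVec V α) (columnVec V γ))
  rw [stateAverage_overlapSqPoly, ← hb, ← hb, overlapMoment_orthonormalBasis, hb, hb] at h1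
  simp only [stateEval_overlapSqPoly, norm_inner_eigenvector_pow hV hl, Fintype.sum_prod_type,
    Finset.sum_const, Finset.card_univ, Fintype.card_prod, Fintype.card_fin] at h1
  rw [← Complex.ofReal_sum, nsmul_eq_mul] at h1
  set S := ∑ β, ‖V β α‖ ^ 2 * ‖V β γ‖ ^ 2
  have hk : ((k : ℝ) + 1) ≠ 0 := by positivity
  have h2 : (1 / (((k + 1 : ℕ) * 3 : ℕ) : ℝ)) * (((k + 1 : ℕ) : ℝ) * S) =
      if α = γ then 1 / 6 else 1 / 12 := by
    rw [← Complex.ofReal_inj, ← h1]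
    push_cast
    rfl
  have h3 : S = 3 * ((1 / (((k + 1 : ℕ) * 3 : ℕ) : ℝ)) * (((k + 1 : ℕ) : ℝ) * S)) := by
    push_cast
    field_simp
  rw [h3, h2]
  split_ifs <;> norm_num

theorem conjTranspose_pow_mul_pow {V : Matrix (Fin 3) (Fin 3) ℂ}
    (hV : V ∈ Matrix.unitaryGroup (Fin 3) ℂ) (l : Fin 3 → ℂ) (i j : ℕ) :
    ((V * Matrix.diagonal l * Vᴴ) ^ i)ᴴ * (V * Matrix.diagonal l * Vᴴ) ^ j =
      V * Matrix.diagonal (fun α => (starRingEnd ℂ) (l α) ^ i * l α ^ j) * Vᴴ := by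
  have hV1 : Vᴴ * V = 1 := Matrix.mem_unitaryGroup_iff'.1 hV
  rw [pow_unitary_conj_diagonal hV, pow_unitary_conj_diagonal hV, Matrix.conjTranspose_mul,
    Matrix.conjTranspose_mul, Matrix.conjTranspose_conjTranspose, Matrix.diagonal_conjTranspose,
    show ∀ A B : Matrix (Fin 3) (Fin 3) ℂ, V * (A * Vᴴ) * (V * B * Vᴴ) = V * A * (Vᴴ * V) * B * Vᴴ
      by intros; simp only [mul_assoc], hV1, mul_one, mul_assoc V, Matrix.diagonal_mul_diagonal]
  congr 3
  ext α
  simp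

/-- The overlap matrix `(U^i)† U^j` is again diagonal in the eigenbasis `V` with unimodular
eigenvalues, so its diagonal already obstructs unbiasedness. -/
theorem not_areUnbiased_pow {V : Matrix (Fin 3) (Fin 3) ℂ}
    (hV : V ∈ Matrix.unitaryGroup (Fin 3) ℂ) (h00 : ∑ β, ‖V β 0‖ ^ 2 * ‖V β 0‖ ^ 2 = 1 / 2)
    (h11 : ∑ β, ‖V β 1‖ ^ 2 * ‖V β 1‖ ^ 2 = 1 / 2) (h01 : ∑ β, ‖V β 0‖ ^ 2 * ‖V β 1‖ ^ 2 = 1 / 4)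
    {l : Fin 3 → ℂ} (hl : ∀ α, ‖l α‖ = 1) (i j : ℕ) :
    ¬ AreUnbiased ((V * Matrix.diagonal l * Vᴴ) ^ i) ((V * Matrix.diagonal l * Vᴴ) ^ j) := by
  intro h
  refine exists_diagonal_norm_sq_ne hV h00 h11 h01
    (l := fun α => (starRingEnd ℂ) (l α) ^ i * l α ^ j) (fun α => by simp [hl]) fun β => ?_
  rw [← conjTranspose_pow_mul_pow hV, ← inner_columnVec, h β β]
  norm_num

/-! ### Cyclic mutually unbiased bases -/

theorem GeneratesCyclicMUB.norm_inner {U : Matrix (Fin 3) (Fin 3) ℂ} (h : GeneratesCyclicMUB U)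
    (x y : Fin 4 × Fin 3) :
    ‖inner ℂ (columnVec (U ^ (x.1 : ℕ)) x.2) (columnVec (U ^ (y.1 : ℕ)) y.2)‖ ^ 2 =
      if x.1 = y.1 then (if x.2 = y.2 then 1 else 0) else 1 / 3 := by
  obtain ⟨⟨i, hi⟩, α⟩ := x
  obtain ⟨⟨j, hj⟩, β⟩ := y
  simp only [Fin.mk.injEq]
  rcases lt_trichotomy i j with hij | rfl | hij
  · rw [if_neg hij.ne, h.2 i j hij (by omega)]
    norm_num
  · have : (U ^ i)ᴴ * U ^ i = 1 := Matrix.mem_unitaryGroup_iff'.1 (pow_mem h.1 i)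
    rw [if_pos rfl, inner_columnVec, this, Matrix.one_apply]
    split_ifs <;> simp
  · rw [if_neg hij.ne', norm_inner_symm, h.2 j i hij (by omega)]
    norm_num

theorem not_generatesCyclicMUB (U : Matrix (Fin 3) (Fin 3) ℂ) : ¬ GeneratesCyclicMUB U := by
  intro h
  obtain ⟨V, hV, l, hl, rfl⟩ := exists_unitary_diagonalization h.1
  obtain ⟨b, hb⟩ := exists_orthonormalBasis_columnVec hV
  set U := V * Matrix.diagonal l * Vᴴ with hU
  -- Each of the 12 vectors contributes 1 from itself and 9·(1/9) from the other three bases, so the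
  -- frame potential is 24.
  have hpot := sum_overlap_of_frame_potential
    (ψ := fun x : Fin 4 × Fin 3 => columnVec (U ^ (x.1 : ℕ)) x.2)
    (fun x => by
      have := h.norm_inner x x
      rw [inner_self_eq_norm_sq_to_K] at this
      simp only [if_true] at this
      rw [norm_pow, ← pow_mul] at this
      simpa [pow_eq_one_iff_of_nonneg] using this)
    (by simp)
    (by
      simp only [h.norm_inner, Fintype.sum_prod_type, Fin.sum_univ_four, Fin.sum_univ_three]
      simp [Fin.ext_iff]
      norm_num)
  -- The factor 4 counts the powers `U^0, …, U^3`, which have equal overlaps with the eigenbasis.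
  have key (α γ : Fin 3) :
      4 * ∑ β, ‖V β α‖ ^ 2 * ‖V β γ‖ ^ 2 = 1 + if α = γ then 1 else 0 := by
    have := hpot (columnVec V α) (columnVec V γ)
    simp only [hU, norm_inner_eigenvector_pow hV hl, Fintype.sum_prod_type, Finset.sum_const,
      Finset.card_univ, Fintype.card_fin, nsmul_eq_mul, Nat.cast_ofNat] at this
    rw [this, ← hb, ← hb, b.norm_eq_one, b.norm_eq_one, b.inner_eq_ite]
    split_ifs <;> simp
  have k00 := key 0 0
  have k11 := key 1 1
  have k01 := key 0 1
  norm_num at k00 k11 k01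
  exact not_areUnbiased_pow hV (by norm_num; linarith) (by norm_num; linarith)
    (by norm_num; linarith) hl 0 1 (h.2 0 1 (by norm_num) (by norm_num))

theorem mainTheorem11 :
    -- no unitary with an eigenbasis decohering to a simplex 2-design is a rescaled Hadamard matrix
    (∀ V ∈ Matrix.unitaryGroup (Fin 3) ℂ, ∀ l : Fin 3 → ℂ, (∀ α, ‖l α‖ = 1) →
      IsSimplexDesign 2 (fun β : Fin 3 => decoherence (columnVec Vᴴ β)) →
      ¬ IsComplexHadamard ((√3 : ℂ) • (V * Matrix.diagonal l * Vᴴ))) ∧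
    -- in particular for the one-parameter family of such eigenbases, with any phases
    (∀ (φ : ℝ), ∀ V ∈ Matrix.unitaryGroup (Fin 3) ℂ, ∀ l : Fin 3 → ℂ, (∀ α, ‖l α‖ = 1) →
      (∀ α β, ‖Vᴴ α β‖ ^ 2 = eigenbasisModuliSq φ α β) →
      ¬ IsComplexHadamard ((√3 : ℂ) • (V * Matrix.diagonal l * Vᴴ))) ∧
    -- no (rescaled) Hadamard matrix, and no pair of unbiased bases, occurs in a cyclic design
    (∀ (t k : ℕ) (U : Matrix (Fin 3) (Fin 3) ℂ), 2 ≤ t → IsCyclicDesign t k U →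
      (∀ j ≤ k, ¬ IsComplexHadamard ((√3 : ℂ) • U ^ j)) ∧
      (∀ i ≤ k, ∀ j ≤ k, ¬ AreUnbiased (U ^ i) (U ^ j))) ∧
    -- there are no cyclic MUB in dimension three
    (¬ ∃ U : Matrix (Fin 3) (Fin 3) ℂ, GeneratesCyclicMUB U) := by
  refine ⟨fun V hV l hl hd => not_isComplexHadamard_of_isSimplexDesign hV hl hd,
    fun φ V hV l hl hm => not_isComplexHadamard_of_moduli hV hl hm, fun t k U ht hU => ?_,
    fun ⟨U, hU⟩ => not_generatesCyclicMUB U hU⟩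
  obtain ⟨V, hV, l, hl, rfl⟩ := exists_unitary_diagonalization hU.1
  have h00 := hU.sum_mul ht hV hl 0 0
  have h11 := hU.sum_mul ht hV hl 1 1
  have h01 := hU.sum_mul ht hV hl 0 1
  rw [if_pos rfl] at h00 h11
  rw [if_neg (by decide)] at h01
  refine ⟨fun j _ h => ?_, fun i _ j _ => not_areUnbiased_pow hV h00 h11 h01 hl i j⟩
  rw [pow_unitary_conj_diagonal hV] at h
  exact exists_diagonal_norm_sq_ne hV h00 h11 h01 (fun α => by simp [hl])
    fun β => h.norm_sq_of_sqrt_three_smul β β
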